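/- For a complex-valued function $v\in L_2(0,\pi)$ with $\int_0^\pi v(x)\,dx=0$, let $\Delta$ be the entire function $$\Delta(\lambda)=\frac{\sin\rho\pi}{\rho}+\int_0^\pi v(x)\,\frac{\cos\rho x}{\rho^2}\,dx,\qquad \rho^2=\lambda,$$ (the value at $\lambda=0$ being defined by continuity), and for another complex-valued function $\tilde v\in L_2(0,\pi)$ with $\int_0^\pi\tilde v(x)\,dx=0$ let $\tilde\Delta$ be defined in the same way with $\tilde v$ in place of $v$. Then for every $r>0$ there is a constant $C_r>0$, depending only on $r$, such that the following holds for all such $v,\tilde v$. Let $\lambda_n=n^2+\varkappa_n$, $n\ge1$, be all the zeros of $\Delta$ and $\tilde\lambda_n=n^2+\tilde\varkappa_n$, $n\ge1$, all the zeros of $\tilde\Delta$, each zero being listed as many times as its multiplicity, where $\{\varkappa_n\}$ and $\{\tilde\varkappa_n\}$ are complex sequences in $l_2$. If $\|\{\varkappa_n\}\|_{l_2}\le r$ and $\|\{\tilde\varkappa_n\}\|_{l_2}\le r$, then $$\|v-\tilde v\|_{L_2(0,\pi)}\le C_r\,\|\{\varkappa_n-\tilde\varkappa_n\}\|_{l_2}.$$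 -/

import Mathlib

open scoped Real

noncomputable section

/-- The complex Hilbert space `L₂(0, π)`. -/
abbrev L2 : Type := MeasureTheory.Lp ℂ 2 (MeasureTheory.volume.restrict (Set.Ioo (0 : ℝ) π))

/-- The space `ℓ₂` of square summable complex sequences. The entry with index `n : ℕ` plays the
role of the entry with index `n + 1` of a sequence indexed by `1, 2, 3, …`. -/
abbrev EllTwo : Type := lp (fun _ : ℕ => ℂ) 2

/-- `Δ` is an entire function of the form
`Δ(λ) = sin (ρπ) / ρ + ∫₀^π v(x) cos (ρx) / ρ² dx`, `ρ² = λ`, where `v ∈ L₂(0, π)` has zero mean.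
(The value at `λ = 0` is determined by continuity.) -/
structure IsCharFun (v : L2) (Δ : ℂ → ℂ) : Prop where
  mean_zero : ∫ x in Set.Ioo (0 : ℝ) π, v x = 0
  entire : Differentiable ℂ Δ
  form : ∀ ρ : ℂ, ρ ≠ 0 →
    Δ (ρ ^ 2) = Complex.sin (ρ * π) / ρ
      + ∫ x in Set.Ioo (0 : ℝ) π, v x * (Complex.cos (ρ * x) / ρ ^ 2)

/-- The sequence `z` lists all zeros of the entire function `Δ`, each zero occurring exactly as
many times as its multiplicity. -/
def IsZeroSeq (Δ : ℂ → ℂ) (z : ℕ → ℂ) : Prop :=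
  ∀ a : ℂ, {n : ℕ | z n = a}.encard = analyticOrderAt Δ a

end

/-!
The theorem reduces to an explicit formula for the cosine coefficients of `v` in terms of the zeros
`λ_k = k² + κ_k` of `Δ`. Putting `ρ = n` in the definition of `Δ` gives
`∫ v(x) cos (nx) dx = n² Δ(n²)`, and comparing `Δ` with the unperturbed function `sin (ρπ) / ρ`,
whose zeros in `λ = ρ²` are the `k²`, gives

`n² Δ(n²) = (π / 2) (-1)^(n-1) κ_n ∏_{k ≠ n} (1 + κ_k / (k² - n²))`.

No factorization theorem for entire functions is needed for this. The zeros with `k ≤ N` are split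
off from `Δ` and from the sine (`exists_differentiable_eq_prod_sub_mul`,
`exists_differentiable_sin_eq_prod_mul`). The quotient of the two cofactors is holomorphic, as a
function of `ρ`, in the square `|Re ρ|, |Im ρ| ≤ N + 1/2`. On the boundary of the square both
`ρ Δ(ρ²) / sin (ρπ)` and `∏_{k ≤ N} (1 + κ_k / (k² - ρ²))` tend to `1` uniformly as `N → ∞`, hence
so does the quotient of the cofactors, and by the maximum modulus principle it tends to `1` at
`ρ = n` as well (`exists_factor`, `tendsto_zeroProd`). The infinite product appears only as the
limit of its truncations `zeroProd`.

Since `|k² - n²| ≥ k` for `k ≠ n`, the sums `∑_{k ≠ n} |κ_k| / |k² - n²|` are at most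
`‖κ‖ (∑ 1 / k²)^(1/2)`, uniformly in `n`. So the products are bounded and Lipschitz in `κ` on balls
of `ℓ₂`, uniformly in `n`, and the differences of the cosine coefficients are bounded in `ℓ₂` by a
constant times `‖κ - κ'‖` (`norm_integral_mul_cos_sub_le`). Parseval's identity for the cosines
(`hasSum_sq_integral_mul_cos`) finishes the proof; the coefficient with index `0` vanishes because
the functions have zero mean.
-/

noncomputable section

/-! ### Perturbation of finite products -/

theorem norm_prod_one_add_le {ι : Type*} (s : Finset ι) (x : ι → ℂ) :
    ‖∏ i ∈ s, (1 + x i)‖ ≤ Real.exp (∑ i ∈ s, ‖x i‖) := by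
  rw [norm_prod, Real.exp_sum]
  refine Finset.prod_le_prod (fun _ _ => norm_nonneg _) fun i _ => ?_
  calc ‖1 + x i‖ ≤ ‖x i‖ + 1 := by simpa [add_comm] using norm_add_le (1 : ℂ) (x i)
    _ ≤ _ := Real.add_one_le_exp _

theorem norm_prod_one_add_sub_prod_one_add_le {ι : Type*} (s : Finset ι) (x y : ι → ℂ) :
    ‖∏ i ∈ s, (1 + x i) - ∏ i ∈ s, (1 + y i)‖ ≤
      Real.exp (∑ i ∈ s, ‖x i‖ + ∑ i ∈ s, ‖y i‖) * ∑ i ∈ s, ‖x i - y i‖ := by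
  classical
  induction s using Finset.induction_on with
  | empty => simp
  | insert a s ha ih =>
    simp only [Finset.sum_insert ha, Finset.prod_insert ha]
    set X := ∏ i ∈ s, (1 + x i)
    set Y := ∏ i ∈ s, (1 + y i)
    set p := ∑ i ∈ s, ‖x i‖ with hp
    set q := ∑ i ∈ s, ‖y i‖
    set d := ∑ i ∈ s, ‖x i - y i‖
    have hp0 : 0 ≤ p := Finset.sum_nonneg fun _ _ => norm_nonneg _
    have hd0 : 0 ≤ d := Finset.sum_nonneg fun _ _ => norm_nonneg _
    have hY : ‖Y‖ ≤ Real.exp q := norm_prod_one_add_le s y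
    have hx : ‖1 + x a‖ ≤ Real.exp ‖x a‖ := by
      simpa using norm_prod_one_add_le {a} x
    calc ‖(1 + x a) * X - (1 + y a) * Y‖
        = ‖(1 + x a) * (X - Y) + (x a - y a) * Y‖ := by congr 1; ring
      _ ≤ ‖1 + x a‖ * ‖X - Y‖ + ‖x a - y a‖ * ‖Y‖ := by
        rw [← norm_mul, ← norm_mul]; exact norm_add_le _ _
      _ ≤ Real.exp ‖x a‖ * (Real.exp (p + q) * d) + ‖x a - y a‖ * Real.exp q := by gcongr
      _ = Real.exp (‖x a‖ + p + q) * d + Real.exp q * ‖x a - y a‖ := by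
        rw [add_assoc, Real.exp_add ‖x a‖]; ring
      _ ≤ Real.exp (‖x a‖ + p + (‖y a‖ + q)) * d
          + Real.exp (‖x a‖ + p + (‖y a‖ + q)) * ‖x a - y a‖ := by
        have := norm_nonneg (x a)
        have := norm_nonneg (y a)
        gcongr <;> linarith
      _ = _ := by ring

/-! ### Dividing an entire function by some of its zeros -/

theorem exists_differentiable_eq_sub_mul {f : ℂ → ℂ} (hf : Differentiable ℂ f) {a : ℂ}
    (ha : f a = 0) : ∃ g : ℂ → ℂ, Differentiable ℂ g ∧ ∀ w, f w = (w - a) * g w := by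
  refine ⟨dslope f a, ?_, fun w => ?_⟩
  · rw [← differentiableOn_univ] at hf ⊢
    exact (Complex.differentiableOn_dslope Filter.univ_mem).2 hf
  · have := sub_smul_dslope f a w
    rw [ha, sub_zero, smul_eq_mul] at this
    exact this.symm

theorem analyticOrderAt_sub_const (a b : ℂ) [Decidable (a = b)] :
    analyticOrderAt (fun w : ℂ => w - a) b = if a = b then 1 else 0 := by
  split_ifs with h
  · subst h; exact analyticOrderAt_id_sub_const_self
  · exact analyticOrderAt_id_sub_const_of_ne (Ne.symm h)

/-- If every point occurs in the finite family `z` at most as often as its order as a zero of the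
entire function `f`, then `f` is divisible by `∏ (w - z i)` in the ring of entire functions. -/
theorem exists_differentiable_eq_prod_sub_mul {ι : Type*} (s : Finset ι) (z : ι → ℂ) {f : ℂ → ℂ}
    (hf : Differentiable ℂ f)
    (h : ∀ a, ((s.filter (fun i => z i = a)).card : ℕ∞) ≤ analyticOrderAt f a) :
    ∃ g : ℂ → ℂ, Differentiable ℂ g ∧ ∀ w, f w = (∏ i ∈ s, (w - z i)) * g w := by
  classical
  induction s using Finset.induction_on generalizing f with
  | empty => exact ⟨f, hf, by simp⟩
  | insert a s ha ih =>
    have h0 : f (z a) = 0 := by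
      apply apply_eq_zero_of_analyticOrderAt_ne_zero
      have := h (z a)
      rw [Finset.filter_insert, if_pos rfl, Finset.card_insert_of_notMem (by simp [ha])] at this
      intro h'
      rw [h'] at this
      simp at this
    obtain ⟨f₁, hf₁, hff₁⟩ := exists_differentiable_eq_sub_mul hf h0
    have hord : ∀ b, analyticOrderAt f b = (if z a = b then 1 else 0) + analyticOrderAt f₁ b := by
      intro b
      have : f = (fun w => w - z a) * f₁ := funext hff₁
      rw [this, analyticOrderAt_mul (by fun_prop) (hf₁.analyticAt b), analyticOrderAt_sub_const]
    obtain ⟨g, hg, hg'⟩ := ih hf₁ fun b => by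
      have := h b
      rw [hord, Finset.filter_insert] at this
      split_ifs at this with hb
      · rw [Finset.card_insert_of_notMem (by simp [ha]), Nat.cast_add, Nat.cast_one,
          add_comm] at this
        exact (ENat.add_le_add_iff_left (by simp)).1 this
      · simpa using this
    refine ⟨g, hg, fun w => ?_⟩
    rw [hff₁, hg', Finset.prod_insert ha, mul_assoc]

/-! ### Splitting off the first zeros of the sine -/

theorem exists_differentiable_sin_eq_prod_mul (N : ℕ) :
    ∃ S : ℂ → ℂ, Differentiable ℂ S ∧ ∀ ρ : ℂ, Complex.sin (ρ * π) =
      ρ * (∏ k ∈ Finset.range N, (ρ ^ 2 - ((k : ℂ) + 1) ^ 2)) * S ρ := by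
  induction N with
  | zero =>
    obtain ⟨S, hS, h⟩ := exists_differentiable_eq_sub_mul (f := fun ρ : ℂ => Complex.sin (ρ * π))
      (by fun_prop) (a := 0) (by simp)
    exact ⟨S, hS, fun ρ => by simpa using h ρ⟩
  | succ N ih =>
    obtain ⟨S, hS, h⟩ := ih
    have hN : ((N : ℂ) + 1) ≠ 0 := Nat.cast_add_one_ne_zero N
    have hP : ∏ k ∈ Finset.range N, (((N : ℂ) + 1) ^ 2 - ((k : ℂ) + 1) ^ 2) ≠ 0 := by
      refine Finset.prod_ne_zero_iff.2 fun k hk => ?_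
      rw [sub_ne_zero]
      have := Finset.mem_range.1 hk
      have h' : (N + 1) ^ 2 ≠ (k + 1) ^ 2 := by
        have : (k + 1) ^ 2 < (N + 1) ^ 2 := by gcongr
        omega
      exact_mod_cast h'
    have hsin : Complex.sin (((N : ℂ) + 1) * π) = 0 := by
      exact_mod_cast Complex.sin_nat_mul_pi (N + 1)
    have h1 : S ((N : ℂ) + 1) = 0 := by
      have := h ((N : ℂ) + 1)
      rw [hsin] at this
      simpa [hN, hP] using this.symm
    have h2 : S (-((N : ℂ) + 1)) = 0 := by
      have := h (-((N : ℂ) + 1))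
      rw [neg_mul, Complex.sin_neg, hsin, neg_sq, neg_zero] at this
      have h3 := mul_ne_zero (neg_ne_zero.2 hN) hP
      exact (mul_eq_zero.1 this.symm).resolve_left h3
    obtain ⟨T, hT, hST⟩ := exists_differentiable_eq_sub_mul hS h1
    have h3 : T (-((N : ℂ) + 1)) = 0 := by
      rw [hST] at h2
      refine (mul_eq_zero.1 h2).resolve_left ?_
      rw [show -((N : ℂ) + 1) - ((N : ℂ) + 1) = -2 * ((N : ℂ) + 1) by ring]
      exact mul_ne_zero (by norm_num) hN
    obtain ⟨W, hW, hTW⟩ := exists_differentiable_eq_sub_mul hT h3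
    refine ⟨W, hW, fun ρ => ?_⟩
    rw [h, hST, hTW, Finset.prod_range_succ]
    ring

section Cofactor

variable {N : ℕ} {S : ℂ → ℂ}

/-- The cofactor `S` has no zeros in the strip `|Re ρ| < N + 1`, as the zeros of the sine are
simple. -/
theorem cofactor_ne_zero (hS : Differentiable ℂ S)
    (h : ∀ ρ : ℂ, Complex.sin (ρ * π) =
      ρ * (∏ k ∈ Finset.range N, (ρ ^ 2 - ((k : ℂ) + 1) ^ 2)) * S ρ)
    {ρ : ℂ} (hρ : |ρ.re| < N + 1) : S ρ ≠ 0 := by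
  intro h0
  have hsin : Complex.sin (ρ * π) = 0 := by rw [h, h0, mul_zero]
  obtain ⟨m, hm⟩ := Complex.sin_eq_zero_iff.1 hsin
  have hρm : ρ = m := mul_right_cancel₀ (Complex.ofReal_ne_zero.2 Real.pi_ne_zero) hm
  set P : ℂ → ℂ := fun ρ => ρ * (∏ k ∈ Finset.range N, (ρ ^ 2 - ((k : ℂ) + 1) ^ 2)) with hPdef
  have hP : P ρ = 0 := by
    rcases eq_or_ne m 0 with rfl | hm0
    · simp [hPdef, hρm]
    · have hlt : m.natAbs < N + 1 := by
        rw [hρm, Complex.intCast_re, ← Int.cast_abs, Int.abs_eq_natAbs] at hρ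
        exact_mod_cast hρ
      have hpos : 0 < m.natAbs := Int.natAbs_pos.2 hm0
      refine mul_eq_zero_of_right _ (Finset.prod_eq_zero (i := m.natAbs - 1)
        (Finset.mem_range.2 (by omega)) ?_)
      have h1 : (((m.natAbs - 1 : ℕ) : ℂ) + 1) = ((m.natAbs : ℤ) : ℂ) := by
        rw [Nat.cast_sub hpos]; simp
      rw [h1, hρm, sub_eq_zero]
      exact_mod_cast (Int.natAbs_sq m).symm
  have hPd : Differentiable ℂ P := by
    rw [hPdef]
    fun_prop
  have hd1 : HasDerivAt (fun ρ : ℂ => Complex.sin (ρ * π)) (Complex.cos (ρ * π) * π) ρ := by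
    simpa using ((hasDerivAt_id ρ).mul_const (π : ℂ)).csin
  have hd2 := (hPd ρ).hasDerivAt.mul (hS ρ).hasDerivAt
  have heq : (fun ρ : ℂ => Complex.sin (ρ * π)) = P * S := funext h
  rw [heq] at hd1
  have h2 := hd1.unique hd2
  rw [h0, hP, mul_zero, zero_mul, add_zero] at h2
  have hcos : Complex.cos (ρ * π) = 0 :=
    (mul_eq_zero.1 h2).resolve_right (Complex.ofReal_ne_zero.2 Real.pi_ne_zero)
  have := Complex.sin_sq_add_cos_sq (ρ * π)
  simp [hsin, hcos] at this

/-- The value of the cofactor `S` at the integer `n + 1`, obtained by differentiating the sine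
there. -/
theorem cofactor_natCast (hS : Differentiable ℂ S)
    (h : ∀ ρ : ℂ, Complex.sin (ρ * π) =
      ρ * (∏ k ∈ Finset.range N, (ρ ^ 2 - ((k : ℂ) + 1) ^ 2)) * S ρ)
    {n : ℕ} (hn : n < N) :
    2 * ((n : ℂ) + 1) ^ 2 *
      (∏ k ∈ (Finset.range N).erase n, (((n : ℂ) + 1) ^ 2 - ((k : ℂ) + 1) ^ 2)) * S (n + 1)
      = π * (-1) ^ (n + 1) := by
  set Q : ℂ → ℂ := fun ρ =>
    ρ * (∏ k ∈ (Finset.range N).erase n, (ρ ^ 2 - ((k : ℂ) + 1) ^ 2)) * S ρ with hQdef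
  have hQd : Differentiable ℂ Q := by
    rw [hQdef]
    fun_prop
  have heq : (fun ρ : ℂ => Complex.sin (ρ * π))
      = (fun ρ : ℂ => ρ ^ 2 - ((n : ℂ) + 1) ^ 2) * Q := by
    funext ρ
    rw [Pi.mul_apply, h, ← Finset.mul_prod_erase _ _ (Finset.mem_range.2 hn), hQdef]
    ring
  have hd1 : HasDerivAt (fun ρ : ℂ => Complex.sin (ρ * π))
      (Complex.cos (((n : ℂ) + 1) * π) * π) ((n : ℂ) + 1) := by
    simpa using ((hasDerivAt_id ((n : ℂ) + 1)).mul_const (π : ℂ)).csin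
  have hd3 : HasDerivAt (fun ρ : ℂ => ρ ^ 2 - ((n : ℂ) + 1) ^ 2) (2 * ((n : ℂ) + 1))
      ((n : ℂ) + 1) := by
    simpa using (hasDerivAt_pow 2 ((n : ℂ) + 1)).sub_const (((n : ℂ) + 1) ^ 2)
  rw [heq] at hd1
  have h2 := hd1.unique (hd3.mul (hQd _).hasDerivAt)
  have hcos : Complex.cos (((n : ℂ) + 1) * π) = (-1) ^ (n + 1) := by
    exact_mod_cast congrArg Complex.ofReal (Real.cos_nat_mul_pi (n + 1))
  rw [hcos] at h2
  rw [mul_comm (π : ℂ), h2, hQdef]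
  ring

end Cofactor

/-! ### Estimates on the boundary of large squares -/

/-- The open square with centre `0` and half side `R` in the `ρ`-plane. -/
def openSquare (R : ℝ) : Set ℂ := Set.Ioo (-R) R ×ℂ Set.Ioo (-R) R

theorem closure_openSquare {R : ℝ} (hR : 0 < R) :
    closure (openSquare R) = Set.Icc (-R) R ×ℂ Set.Icc (-R) R := by
  rw [openSquare, Complex.closure_reProdIm, closure_Ioo (by linarith)]

theorem frontier_openSquare {R : ℝ} (hR : 0 < R) {ρ : ℂ} (hρ : ρ ∈ frontier (openSquare R)) :
    (|ρ.re| = R ∧ |ρ.im| ≤ R) ∨ (|ρ.im| = R ∧ |ρ.re| ≤ R) := by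
  have h : -R < R := by linarith
  rw [openSquare, Complex.frontier_reProdIm, closure_Ioo h.ne, frontier_Ioo h] at hρ
  rcases hρ with ⟨h1, h2⟩ | ⟨h1, h2⟩
  · exact .inr ⟨by rcases h2 with h2 | h2 <;> simp_all [abs_of_pos], abs_le.2 h1⟩
  · exact .inl ⟨by rcases h1 with h1 | h1 <;> simp_all [abs_of_pos], abs_le.2 h2⟩

theorem norm_sin_sq (z : ℂ) :
    ‖Complex.sin z‖ ^ 2 = Real.sin z.re ^ 2 + Real.sinh z.im ^ 2 := by
  rw [Complex.sin_eq, Complex.sq_norm, Complex.normSq_apply]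
  have h1 := Real.sin_sq_add_cos_sq z.re
  have h2 := Real.cosh_sq z.im
  simp only [← Complex.ofReal_sin, ← Complex.ofReal_cos, ← Complex.ofReal_sinh,
    ← Complex.ofReal_cosh, Complex.add_re, Complex.add_im, Complex.mul_re, Complex.mul_im,
    Complex.ofReal_re, Complex.ofReal_im, Complex.I_re, Complex.I_im]
  ring_nf
  rw [h2, show Real.cos z.re ^ 2 = 1 - Real.sin z.re ^ 2 by linarith]
  ring

theorem norm_cos_le (z : ℂ) : ‖Complex.cos z‖ ≤ Real.exp |z.im| := by
  rw [Complex.cos, norm_div]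
  have h1 : ‖Complex.exp (z * .I)‖ ≤ Real.exp |z.im| := by
    rw [Complex.norm_exp]; simpa using neg_le_abs z.im
  have h2 : ‖Complex.exp (-z * .I)‖ ≤ Real.exp |z.im| := by
    rw [Complex.norm_exp]; simpa using le_abs_self z.im
  have := norm_add_le (Complex.exp (z * .I)) (Complex.exp (-z * .I))
  rw [Complex.norm_ofNat, div_le_iff₀ (by norm_num)]
  linarith

/-- On the vertical sides, where `Re ρ` is half an odd integer, `|sin (ρπ)| = cosh (π Im ρ)`; on the
horizontal ones `|sin (ρπ)| ≥ sinh (π |Im ρ|)`. -/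
theorem exp_le_four_mul_norm_sin (N : ℕ) {ρ : ℂ}
    (hρ : ρ ∈ frontier (openSquare (N + 1 / 2))) :
    Real.exp (π * |ρ.im|) ≤ 4 * ‖Complex.sin (ρ * π)‖ := by
  have hpi := Real.pi_gt_three
  have hR : (0 : ℝ) < N + 1 / 2 := by positivity
  have hsq := norm_sin_sq (ρ * π)
  rw [Complex.re_mul_ofReal, Complex.im_mul_ofReal] at hsq
  have habs : |ρ.im * π| = π * |ρ.im| := by rw [abs_mul, abs_of_pos Real.pi_pos, mul_comm]
  rcases frontier_openSquare hR hρ with ⟨h, -⟩ | ⟨h, -⟩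
  · have hsin : Real.sin (ρ.re * π) ^ 2 = 1 := by
      have hc : Real.cos (ρ.re * π) = 0 := by
        rw [← Real.cos_abs, abs_mul, h, abs_of_pos Real.pi_pos, add_mul, Real.cos_add]
        rw [show 1 / 2 * π = π / 2 by ring, Real.cos_pi_div_two, Real.sin_nat_mul_pi]
        simp
      have := Real.sin_sq_add_cos_sq (ρ.re * π)
      rw [hc] at this
      simpa using this
    rw [hsin, add_comm, ← Real.cosh_sq] at hsq
    have h1 : ‖Complex.sin (ρ * π)‖ = Real.cosh (ρ.im * π) :=
      (sq_eq_sq₀ (norm_nonneg _) (Real.cosh_pos _).le).1 hsq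
    rw [h1, ← Real.cosh_abs, habs, Real.cosh_eq]
    have := Real.exp_pos (π * |ρ.im|)
    have := Real.exp_pos (-(π * |ρ.im|))
    linarith
  · have h1 : Real.sinh (π * |ρ.im|) ≤ ‖Complex.sin (ρ * π)‖ := by
      refine le_of_sq_le_sq ?_ (norm_nonneg _)
      rw [hsq, ← habs, ← Real.abs_sinh, sq_abs]
      nlinarith [sq_nonneg (Real.sin (ρ.re * π))]
    rw [Real.sinh_eq] at h1
    have h2 : (1 : ℝ) ≤ π * |ρ.im| := by
      rw [h]
      have : (0 : ℝ) ≤ N := N.cast_nonneg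
      nlinarith
    have h3 : (2 : ℝ) ≤ Real.exp (π * |ρ.im|) := by
      have := Real.add_one_le_exp (π * |ρ.im|)
      linarith
    have h4 : Real.exp (-(π * |ρ.im|)) ≤ 1 := Real.exp_le_one_iff.2 (by linarith)
    linarith

/-- This crude bound suffices: summed over `k < N` by the Cauchy-Schwarz inequality, it bounds the
perturbation of the product on the boundary of the square by a multiple of `N ^ (-1 / 2)`. -/
theorem half_le_norm_sq_sub_sq {N k : ℕ} (hk : k < N) {ρ : ℂ}
    (hρ : ρ ∈ frontier (openSquare (N + 1 / 2))) :
    ((N : ℝ) + 1 / 2) / 2 ≤ ‖((k : ℂ) + 1) ^ 2 - ρ ^ 2‖ := by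
  have hR : (0 : ℝ) < N + 1 / 2 := by positivity
  have hN : (1 : ℝ) ≤ N := by exact_mod_cast (by omega : 1 ≤ N)
  have hkN : (k : ℝ) + 1 ≤ N := by exact_mod_cast hk
  have hk0 : (0 : ℝ) ≤ k := k.cast_nonneg
  rw [sq_sub_sq, norm_mul]
  have hre1 := Complex.abs_re_le_norm ((k : ℂ) + 1 + ρ)
  have hre2 := Complex.abs_re_le_norm ((k : ℂ) + 1 - ρ)
  have him1 := Complex.abs_im_le_norm ((k : ℂ) + 1 + ρ)
  have him2 := Complex.abs_im_le_norm ((k : ℂ) + 1 - ρ)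
  simp only [Complex.add_re, Complex.sub_re, Complex.add_im, Complex.sub_im, Complex.natCast_re,
    Complex.natCast_im, Complex.one_re, Complex.one_im, zero_add, add_zero, zero_sub,
    abs_neg] at hre1 hre2 him1 him2
  rcases frontier_openSquare hR hρ with ⟨h, -⟩ | ⟨h, -⟩
  · rcases abs_choice ρ.re with h' | h' <;> rw [h'] at h
    · have h1 : (N : ℝ) + 1 / 2 ≤ ‖(k : ℂ) + 1 + ρ‖ := by
        linarith [le_abs_self ((k : ℝ) + 1 + ρ.re)]
      have h2 : 1 / 2 ≤ ‖(k : ℂ) + 1 - ρ‖ := by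
        linarith [neg_le_abs ((k : ℝ) + 1 - ρ.re)]
      nlinarith
    · have h1 : (N : ℝ) + 1 / 2 ≤ ‖(k : ℂ) + 1 - ρ‖ := by
        linarith [le_abs_self ((k : ℝ) + 1 - ρ.re)]
      have h2 : 1 / 2 ≤ ‖(k : ℂ) + 1 + ρ‖ := by
        linarith [neg_le_abs ((k : ℝ) + 1 + ρ.re)]
      nlinarith
  · rw [h] at him1 him2
    nlinarith

/-- On the boundary of the square the characteristic function is close to the unperturbed one. -/
theorem norm_charFun_mul_div_sin_sub_one_le {v : L2} {Δ : ℂ → ℂ} (hΔ : IsCharFun v Δ) (N : ℕ)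
    {ρ : ℂ} (hρ : ρ ∈ frontier (openSquare (N + 1 / 2))) :
    ‖Δ (ρ ^ 2) * ρ / Complex.sin (ρ * π) - 1‖ ≤
      4 * (∫ x in Set.Ioo 0 π, ‖v x‖) / (N + 1 / 2) := by
  have hR : (0 : ℝ) < N + 1 / 2 := by positivity
  have hnorm : (N : ℝ) + 1 / 2 ≤ ‖ρ‖ := by
    rcases frontier_openSquare hR hρ with ⟨h, -⟩ | ⟨h, -⟩
    · rw [← h]; exact Complex.abs_re_le_norm ρ
    · rw [← h]; exact Complex.abs_im_le_norm ρ
  have hρ0 : ρ ≠ 0 := norm_pos_iff.1 (hR.trans_le hnorm)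
  have hexp := exp_le_four_mul_norm_sin N hρ
  have hE := Real.exp_pos (π * |ρ.im|)
  have hsin0 : Complex.sin (ρ * π) ≠ 0 := norm_pos_iff.1 (by linarith)
  set J := ∫ x in Set.Ioo (0 : ℝ) π, v x * Complex.cos (ρ * x)
  have hform : Δ (ρ ^ 2) = Complex.sin (ρ * π) / ρ + J / ρ ^ 2 := by
    rw [hΔ.form ρ hρ0]
    simp_rw [← mul_div_assoc]
    rw [MeasureTheory.integral_div]
  have hv : MeasureTheory.IntegrableOn v (Set.Ioo 0 π) :=
    (MeasureTheory.Lp.memLp v).integrable (by norm_num)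
  have hJ : ‖J‖ ≤ (∫ x in Set.Ioo 0 π, ‖v x‖) * Real.exp (π * |ρ.im|) := by
    rw [← MeasureTheory.integral_mul_const]
    refine MeasureTheory.norm_integral_le_of_norm_le (hv.norm.mul_const _) ?_
    filter_upwards [MeasureTheory.ae_restrict_mem measurableSet_Ioo] with x hx
    rw [norm_mul]
    gcongr
    refine (norm_cos_le _).trans (Real.exp_le_exp.2 ?_)
    rw [Complex.im_mul_ofReal, abs_mul, abs_of_pos hx.1, mul_comm]
    exact mul_le_mul_of_nonneg_right hx.2.le (abs_nonneg _)
  have heq : Δ (ρ ^ 2) * ρ / Complex.sin (ρ * π) - 1 = J / (ρ * Complex.sin (ρ * π)) := by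
    rw [hform]
    field_simp
    ring
  have hV : 0 ≤ ∫ x in Set.Ioo 0 π, ‖v x‖ := MeasureTheory.integral_nonneg fun _ => norm_nonneg _
  rw [heq, norm_div, norm_mul, div_le_div_iff₀ (by positivity) hR]
  calc ‖J‖ * (N + 1 / 2)
      ≤ ((∫ x in Set.Ioo 0 π, ‖v x‖) * (4 * ‖Complex.sin (ρ * π)‖)) * ‖ρ‖ := by
        gcongr
        exact hJ.trans (by gcongr)
    _ = _ := by ring

theorem sum_norm_sq_le (κ : EllTwo) (s : Finset ℕ) : ∑ k ∈ s, ‖κ k‖ ^ 2 ≤ ‖κ‖ ^ 2 := by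
  simpa using lp.sum_rpow_le_norm_rpow (p := 2) (by simp) κ s

theorem sum_norm_mul_le (κ : EllTwo) (s : Finset ℕ) (a : ℕ → ℝ) :
    ∑ k ∈ s, ‖κ k‖ * a k ≤ ‖κ‖ * √(∑ k ∈ s, a k ^ 2) := by
  refine (Real.sum_mul_le_sqrt_mul_sqrt s _ _).trans ?_
  gcongr
  exact Real.sqrt_le_iff.2 ⟨norm_nonneg _, sum_norm_sq_le κ s⟩

theorem sum_norm_div_le_of_mem_frontier (κ : EllTwo) (N : ℕ) {ρ : ℂ}
    (hρ : ρ ∈ frontier (openSquare (N + 1 / 2))) :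
    ∑ k ∈ Finset.range N, ‖κ k / (((k : ℂ) + 1) ^ 2 - ρ ^ 2)‖ ≤
      ‖κ‖ * √N * (2 / (N + 1 / 2)) := by
  have hR : (0 : ℝ) < N + 1 / 2 := by positivity
  calc ∑ k ∈ Finset.range N, ‖κ k / (((k : ℂ) + 1) ^ 2 - ρ ^ 2)‖
      ≤ ∑ k ∈ Finset.range N, ‖κ k‖ * 1 * (2 / (N + 1 / 2)) := by
        refine Finset.sum_le_sum fun k hk => ?_
        rw [norm_div, div_eq_mul_inv, mul_one]
        gcongr
        rw [← inv_div]
        exact inv_anti₀ (by positivity) (half_le_norm_sq_sub_sq (Finset.mem_range.1 hk) hρ)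
    _ ≤ _ := by
        rw [← Finset.sum_mul]
        gcongr
        simpa using sum_norm_mul_le κ (Finset.range N) fun _ => 1

/-! ### Parseval's identity for the cosine system -/

open MeasureTheory in
/-- Parseval's identity for the cosines on `(0, π)` and a function of zero mean: it is Parseval's
identity on `(-π, π)` for the even extension. -/
theorem hasSum_sq_integral_mul_cos {w : ℝ → ℂ}
    (hw : MemLp w 2 (volume.restrict (Set.Ioo 0 π))) (hmean : ∫ x in Set.Ioo 0 π, w x = 0) :
    HasSum (fun n : ℕ => ‖∫ x in Set.Ioo 0 π, w x * Complex.cos (((n : ℂ) + 1) * x)‖ ^ 2)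
      (π / 2 * ∫ x in Set.Ioo 0 π, ‖w x‖ ^ 2) := by
  have hpi := Real.pi_pos
  have hlt : -π < π := by linarith
  set w₀ : ℝ → ℂ := (Set.Ioo 0 π).indicator w with hw₀def
  have hw₀ : MemLp w₀ 2 volume := (memLp_indicator_iff_restrict measurableSet_Ioo).2 hw
  have hw₀' : MemLp (fun x => w₀ (-x)) 2 volume :=
    hw₀.comp_measurePreserving (Measure.measurePreserving_neg volume)
  have hw₀int : Integrable w₀ :=
    (integrable_indicator_iff measurableSet_Ioo).2 (hw.integrable (by norm_num))
  have hrestr {E : Type} [NormedAddCommGroup E] [NormedSpace ℝ E] (F : ℝ → E)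
      (hF : ∀ x ∉ Set.Ioo 0 π, F x = 0) :
      ∫ x in (-π)..π, F x = ∫ x in Set.Ioo 0 π, F x := by
    rw [intervalIntegral.integral_of_le hlt.le]
    refine (setIntegral_eq_of_subset_of_forall_sdiff_eq_zero measurableSet_Ioc ?_ ?_)
    · exact fun x hx => ⟨by linarith [hx.1], hx.2.le⟩
    · exact fun x hx => hF x hx.2
  set f : ℝ → ℂ := fun x => w₀ x + w₀ (-x) with hf
  have hfL : MemLp f 2 (volume.restrict (Set.Ioc (-π) π)) := (hw₀.add hw₀').restrict _
  have hcoeff (n : ℤ) : fourierCoeffOn hlt f n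
      = (1 / π : ℂ) * ∫ x in Set.Ioo 0 π, w x * Complex.cos (n * x) := by
    have hfour (x : ℝ) : fourier (-n) (x : AddCircle (π - -π)) = Complex.exp (-(n * x) * .I) := by
      rw [fourier_coe_apply]
      congr 1
      push_cast
      field_simp
      ring
    have hint (c : ℂ) : IntervalIntegrable (fun x : ℝ => Complex.exp (c * x) * w₀ x) volume
        (-π) π :=
      (hw₀int.intervalIntegrable).continuousOn_mul (by fun_prop)
    have hint' (c : ℂ) : IntervalIntegrable (fun x : ℝ => Complex.exp (c * x) * w₀ (-x)) volume
        (-π) π := by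
      refine IntervalIntegrable.continuousOn_mul ?_ (by fun_prop)
      exact hw₀int.comp_neg.intervalIntegrable
    have hneg : ∫ x in (-π)..π, Complex.exp ((-n * .I) * x) * w₀ (-x)
        = ∫ x in (-π)..π, Complex.exp ((n * .I) * x) * w₀ x := by
      have := intervalIntegral.integral_comp_neg (a := -π) (b := π)
        (fun x : ℝ => Complex.exp ((n * .I) * x) * w₀ x)
      rw [neg_neg] at this
      rw [← this]
      refine intervalIntegral.integral_congr fun x _ => ?_
      simp
    calc fourierCoeffOn hlt f n
        = (1 / (π - -π)) • ∫ x in (-π)..π, (Complex.exp ((-n * .I) * x) * w₀ x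
            + Complex.exp ((-n * .I) * x) * w₀ (-x)) := by
          rw [fourierCoeffOn_eq_integral]
          congr 1
          refine intervalIntegral.integral_congr fun x _ => ?_
          simp only [hfour, hf, smul_eq_mul, ← mul_add]
          ring_nf
      _ = (1 / (π - -π)) • ∫ x in (-π)..π, (Complex.exp ((-n * .I) * x) * w₀ x
            + Complex.exp ((n * .I) * x) * w₀ x) := by
          rw [intervalIntegral.integral_add (hint _) (hint' _),
            intervalIntegral.integral_add (hint _) (hint _), hneg]
      _ = (1 / (π - -π)) • ∫ x in Set.Ioo 0 π, 2 * (w x * Complex.cos (n * x)) := by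
          rw [hrestr _ fun x hx => by simp [hw₀def, Set.indicator_of_notMem hx]]
          congr 1
          refine setIntegral_congr_fun measurableSet_Ioo fun x hx => ?_
          simp only [hw₀def, Set.indicator_of_mem hx]
          rw [mul_left_comm, Complex.two_cos]
          ring_nf
      _ = _ := by
          rw [integral_const_mul, Complex.real_smul]
          push_cast
          field_simp
          ring
  have hnorm : ∫ x in (-π)..π, ‖f x‖ ^ 2 = 2 * ∫ x in Set.Ioo 0 π, ‖w x‖ ^ 2 := by
    have hsq (x : ℝ) : ‖f x‖ ^ 2 = ‖w₀ x‖ ^ 2 + ‖w₀ (-x)‖ ^ 2 := by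
      -- at most one of `x`, `-x` lies in `(0, π)`
      rcases le_or_gt x 0 with hx | hx
      · have : w₀ x = 0 := Set.indicator_of_notMem (fun h => hx.not_gt h.1) _
        simp [hf, this]
      · have : w₀ (-x) = 0 := Set.indicator_of_notMem (fun h => by linarith [h.1]) _
        simp [hf, this]
    have hi : Integrable (fun x => ‖w₀ x‖ ^ 2) := hw₀.integrable_norm_pow (by norm_num)
    have hneg : ∫ x in (-π)..π, ‖w₀ (-x)‖ ^ 2 = ∫ x in (-π)..π, ‖w₀ x‖ ^ 2 := by
      simpa using intervalIntegral.integral_comp_neg (a := -π) (b := π) fun x => ‖w₀ x‖ ^ 2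
    simp_rw [hsq]
    rw [intervalIntegral.integral_add hi.intervalIntegrable hi.comp_neg.intervalIntegrable, hneg,
      hrestr _ fun x hx => by simp [hw₀def, Set.indicator_of_notMem hx], ← two_mul]
    congr 1
    refine setIntegral_congr_fun measurableSet_Ioo fun x hx => ?_
    simp only [hw₀def, Set.indicator_of_mem hx]
  have h := hasSum_sq_fourierCoeffOn hlt hfL
  have h2 := h.nat_add_neg
  have h0 : fourierCoeffOn hlt f 0 = 0 := by rw [hcoeff]; simp [hmean]
  rw [hnorm, h0, norm_zero] at h2
  have h3 := ((hasSum_nat_add_iff' 1).2 h2).mul_left (π ^ 2 / 2)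
  convert! h3 using 1
  · funext n
    rw [hcoeff, hcoeff]
    have : ∀ x : ℝ, Complex.cos (((-((n + 1 : ℕ) : ℤ) : ℤ) : ℂ) * x)
        = Complex.cos (((n : ℂ) + 1) * x) := fun x => by
      rw [← Complex.cos_neg]; congr 1; push_cast; ring
    simp_rw [this]
    push_cast
    rw [norm_mul]
    simp only [norm_div, norm_one, Complex.norm_real, Real.norm_eq_abs, abs_of_pos hpi]
    field_simp
    ring
  · rw [Finset.sum_range_one, Nat.cast_zero, neg_zero, h0, smul_eq_mul, norm_zero]
    field_simp
    ring

/-! ### The cosine coefficients of `v` in terms of the zeros -/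

theorem norm_div_sub_one_le {A B : ℂ} (hB : ‖B - 1‖ ≤ 1 / 2) :
    ‖A / B - 1‖ ≤ 2 * (‖A - 1‖ + ‖B - 1‖) := by
  have hB' : 1 / 2 ≤ ‖B‖ := by
    have := norm_sub_norm_le (1 : ℂ) B
    rw [norm_one, norm_sub_rev] at this
    linarith
  have hB0 : B ≠ 0 := norm_pos_iff.1 (by linarith)
  rw [show A / B - 1 = ((A - 1) - (B - 1)) / B by field_simp; ring, norm_div,
    div_le_iff₀ (by linarith)]
  have := norm_sub_le (A - 1) (B - 1)
  nlinarith [norm_nonneg (A - 1), norm_nonneg (B - 1)]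

/-- The truncated product `∏ (1 + κ_k / ((k + 1)² - (n + 1)²))` over `k < N`, `k ≠ n`, which is the
factor by which the zeros other than the one near `(n + 1)²` perturb the value of the
characteristic function at `(n + 1)²`. -/
def zeroProd (κ : ℕ → ℂ) (n N : ℕ) : ℂ :=
  ∏ k ∈ (Finset.range N).erase n, (1 + κ k / (((k : ℂ) + 1) ^ 2 - ((n : ℂ) + 1) ^ 2))

theorem natCast_add_one_sq_sub_ne_zero {k n : ℕ} (h : k ≠ n) :
    ((k : ℂ) + 1) ^ 2 - ((n : ℂ) + 1) ^ 2 ≠ 0 := by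
  rw [sub_ne_zero]
  have : (k + 1) ^ 2 ≠ (n + 1) ^ 2 := fun h' => h (by
    have := Nat.pow_left_injective (n := 2) (by norm_num) h'
    omega)
  exact_mod_cast this

theorem integral_mul_cos_eq {v : L2} {Δ : ℂ → ℂ} (hΔ : IsCharFun v Δ) (n : ℕ) :
    ∫ x in Set.Ioo 0 π, v x * Complex.cos (((n : ℂ) + 1) * x) =
      ((n : ℂ) + 1) ^ 2 * Δ (((n : ℂ) + 1) ^ 2) := by
  have hn : (n : ℂ) + 1 ≠ 0 := Nat.cast_add_one_ne_zero n
  have hsin : Complex.sin (((n : ℂ) + 1) * π) = 0 := by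
    exact_mod_cast Complex.sin_nat_mul_pi (n + 1)
  rw [hΔ.form _ hn, hsin]
  simp_rw [← mul_div_assoc]
  rw [MeasureTheory.integral_div]
  field_simp
  simp

/-- With the first `N` zeros split off from `Δ` (leaving `g`) and from the sine (leaving `S`), the
quotient `g (ρ²) / S ρ` is holomorphic in the square of half side `N + 1 / 2` and nearly `1` on its
boundary, hence nearly `1` inside by the maximum modulus principle. Its value at `n + 1` is the
factor `h`. -/
theorem exists_factor {v : L2} {Δ : ℂ → ℂ} {κ : EllTwo} (hΔ : IsCharFun v Δ)
    (hz : IsZeroSeq Δ fun n => ((n : ℂ) + 1) ^ 2 + κ n) {n N : ℕ} (hn : n < N) {ε : ℝ}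
    (hε : ε = ‖κ‖ * √N * (2 / (N + 1 / 2))) (hε' : Real.exp ε * ε ≤ 1 / 2) :
    ∃ h : ℂ, ‖h - 1‖ ≤
        2 * (4 * (∫ x in Set.Ioo 0 π, ‖v x‖) / (N + 1 / 2) + Real.exp ε * ε) ∧
      ∫ x in Set.Ioo 0 π, v x * Complex.cos (((n : ℂ) + 1) * x) =
        π / 2 * (-1) ^ n * κ n * zeroProd κ n N * h := by
  have hR : (0 : ℝ) < N + 1 / 2 := by positivity
  obtain ⟨g, hg, hΔg⟩ := exists_differentiable_eq_prod_sub_mul (Finset.range N)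
    (fun n => ((n : ℂ) + 1) ^ 2 + κ n) hΔ.entire fun a => by
      rw [← hz a, ← Set.encard_coe_eq_coe_finsetCard]
      exact Set.encard_le_encard fun k hk => by simpa using (Finset.mem_filter.1 hk).2
  obtain ⟨S, hS, hsin⟩ := exists_differentiable_sin_eq_prod_mul N
  have hS0 : ∀ ρ ∈ closure (openSquare (N + 1 / 2)), S ρ ≠ 0 := by
    intro ρ hρ
    rw [closure_openSquare hR] at hρ
    exact cofactor_ne_zero hS hsin ((abs_le.2 hρ.1).trans_lt (by linarith))
  have hdiff : DiffContOnCl ℂ (fun ρ => g (ρ ^ 2) / S ρ - 1) (openSquare (N + 1 / 2)) := by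
    refine DifferentiableOn.diffContOnCl fun ρ hρ => ?_
    refine DifferentiableAt.differentiableWithinAt (.sub_const (.div ?_ (hS ρ) (hS0 ρ hρ)) _)
    exact DifferentiableAt.comp ρ (hg _) (by fun_prop)
  have hfrontier : ∀ ρ ∈ frontier (openSquare (N + 1 / 2)), ‖g (ρ ^ 2) / S ρ - 1‖ ≤
      2 * (4 * (∫ x in Set.Ioo 0 π, ‖v x‖) / (N + 1 / 2) + Real.exp ε * ε) := by
    intro ρ hρ
    have hA := norm_charFun_mul_div_sin_sub_one_le hΔ N hρ
    have hsum := sum_norm_div_le_of_mem_frontier κ N hρ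
    rw [← hε] at hsum
    set B := ∏ k ∈ Finset.range N, (1 + κ k / (((k : ℂ) + 1) ^ 2 - ρ ^ 2)) with hBdef
    have hB : ‖B - 1‖ ≤ Real.exp ε * ε := by
      have := norm_prod_one_add_sub_prod_one_add_le (Finset.range N)
        (fun k => κ k / (((k : ℂ) + 1) ^ 2 - ρ ^ 2)) 0
      simp only [Pi.zero_apply, add_zero, Finset.prod_const_one, norm_zero, Finset.sum_const_zero,
        sub_zero] at this
      refine this.trans ?_
      gcongr
    have hB0 : B ≠ 0 := by
      rintro h0
      rw [h0, zero_sub, norm_neg, norm_one] at hB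
      linarith
    have hsin0 : Complex.sin (ρ * π) ≠ 0 := by
      have := exp_le_four_mul_norm_sin N hρ
      have := Real.exp_pos (π * |ρ.im|)
      exact norm_pos_iff.1 (by linarith)
    have hprod : ∏ k ∈ Finset.range N, (ρ ^ 2 - (((k : ℂ) + 1) ^ 2 + κ k))
        = (∏ k ∈ Finset.range N, (ρ ^ 2 - ((k : ℂ) + 1) ^ 2)) * B := by
      rw [hBdef, ← Finset.prod_mul_distrib]
      refine Finset.prod_congr rfl fun k hk => ?_
      have h0 : ((k : ℂ) + 1) ^ 2 - ρ ^ 2 ≠ 0 := norm_pos_iff.1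
        ((by positivity : (0 : ℝ) < (N + 1 / 2) / 2).trans_le
          (half_le_norm_sq_sub_sq (Finset.mem_range.1 hk) hρ))
      field_simp
      ring
    have heq : g (ρ ^ 2) / S ρ = Δ (ρ ^ 2) * ρ / Complex.sin (ρ * π) / B := by
      rw [hΔg, hprod, hsin]
      rw [hsin] at hsin0
      have h1 := right_ne_zero_of_mul hsin0
      have h2 := left_ne_zero_of_mul (left_ne_zero_of_mul hsin0)
      have h3 := right_ne_zero_of_mul (left_ne_zero_of_mul hsin0)
      field_simp
    rw [heq]
    refine (norm_div_sub_one_le (hB.trans hε')).trans ?_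
    gcongr
  have hmem : (n : ℂ) + 1 ∈ closure (openSquare (N + 1 / 2)) := by
    have h1 : (n : ℝ) + 1 ≤ N := by exact_mod_cast hn
    have h0 : (0 : ℝ) ≤ n := n.cast_nonneg
    rw [closure_openSquare hR, Complex.mem_reProdIm]
    simp only [Complex.add_re, Complex.natCast_re, Complex.one_re, Complex.add_im,
      Complex.natCast_im, Complex.one_im, add_zero, Set.mem_Icc]
    refine ⟨⟨?_, ?_⟩, ⟨?_, ?_⟩⟩ <;> linarith
  have hbdd : Bornology.IsBounded (openSquare (N + 1 / 2)) :=
    (Metric.isBounded_Ioo _ _).reProdIm (Metric.isBounded_Ioo _ _)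
  refine ⟨_, Complex.norm_le_of_forall_mem_frontier_norm_le hbdd hdiff hfrontier hmem, ?_⟩
  have hSn := hS0 _ hmem
  have hval := cofactor_natCast hS hsin hn
  have hprod : ∏ k ∈ (Finset.range N).erase n,
      (((n : ℂ) + 1) ^ 2 - (((k : ℂ) + 1) ^ 2 + κ k)) =
      (∏ k ∈ (Finset.range N).erase n, (((n : ℂ) + 1) ^ 2 - ((k : ℂ) + 1) ^ 2)) *
        zeroProd κ n N := by
    rw [zeroProd, ← Finset.prod_mul_distrib]
    refine Finset.prod_congr rfl fun k hk => ?_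
    have h0 := natCast_add_one_sq_sub_ne_zero (Finset.ne_of_mem_erase hk)
    field_simp
    ring
  rw [integral_mul_cos_eq hΔ, hΔg, ← Finset.mul_prod_erase _ _ (Finset.mem_range.2 hn), hprod]
  have hπ : (π : ℂ) * (-1) ^ n = -(2 * ((n : ℂ) + 1) ^ 2 *
      (∏ k ∈ (Finset.range N).erase n, (((n : ℂ) + 1) ^ 2 - ((k : ℂ) + 1) ^ 2)) * S (n + 1)) := by
    rw [hval, pow_succ]; ring
  rw [div_mul_eq_mul_div, hπ]
  field_simp
  ring

open Filter Topology in
/-- The cosine coefficients of `v` are determined by the zeros of its characteristic function. -/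
theorem tendsto_zeroProd {v : L2} {Δ : ℂ → ℂ} {κ : EllTwo} (hΔ : IsCharFun v Δ)
    (hz : IsZeroSeq Δ fun n => ((n : ℂ) + 1) ^ 2 + κ n) (n : ℕ) :
    Tendsto (fun N => π / 2 * (-1) ^ n * κ n * zeroProd κ n N) atTop
      (𝓝 (∫ x in Set.Ioo 0 π, v x * Complex.cos (((n : ℂ) + 1) * x))) := by
  set V := ∫ x in Set.Ioo 0 π, ‖v x‖
  set ε : ℕ → ℝ := fun N => ‖κ‖ * √N * (2 / (N + 1 / 2)) with hεdef
  have hRlim : Tendsto (fun N : ℕ => (N : ℝ) + 1 / 2) atTop atTop :=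
    tendsto_atTop_add_const_right _ _ tendsto_natCast_atTop_atTop
  have hεlim : Tendsto ε atTop (𝓝 0) := by
    have hsqrt : Tendsto (fun N : ℕ => 2 * ‖κ‖ / √(N : ℝ)) atTop (𝓝 0) :=
      tendsto_const_nhds.div_atTop (Real.tendsto_sqrt_atTop.comp tendsto_natCast_atTop_atTop)
    refine squeeze_zero' (.of_forall fun N => by positivity) ?_ hsqrt
    filter_upwards [eventually_gt_atTop 0] with N hN
    have hN' : (0 : ℝ) < N := by exact_mod_cast hN
    have hs : 0 < √(N : ℝ) := Real.sqrt_pos.2 hN'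
    rw [hεdef, le_div_iff₀ hs]
    calc ‖κ‖ * √N * (2 / (N + 1 / 2)) * √N = ‖κ‖ * (√N * √N) * (2 / (N + 1 / 2)) := by ring
      _ = 2 * ‖κ‖ * (N / (N + 1 / 2)) := by rw [Real.mul_self_sqrt hN'.le]; ring
      _ ≤ 2 * ‖κ‖ * 1 := by
        gcongr
        rw [div_le_one (by positivity)]
        linarith
      _ = _ := mul_one _
  have hηlim : Tendsto (fun N => Real.exp (ε N) * ε N) atTop (𝓝 0) := by
    simpa using ((Real.continuous_exp.tendsto 0).comp hεlim).mul hεlim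
  have hδlim : Tendsto (fun N : ℕ => 2 * (4 * V / ((N : ℝ) + 1 / 2) + Real.exp (ε N) * ε N)) atTop
      (𝓝 0) := by
    have h1 : Tendsto (fun N : ℕ => 4 * V / ((N : ℝ) + 1 / 2)) atTop (𝓝 0) :=
      tendsto_const_nhds.div_atTop hRlim
    simpa using (h1.add hηlim).const_mul 2
  have hsmall : ∀ᶠ N in atTop, n < N ∧ Real.exp (ε N) * ε N ≤ 1 / 2 :=
    (eventually_gt_atTop n).and (hηlim.eventually_le_const (by norm_num))
  have hex : ∀ N, ∃ h : ℂ, n < N ∧ Real.exp (ε N) * ε N ≤ 1 / 2 →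
      ‖h - 1‖ ≤ 2 * (4 * V / (N + 1 / 2) + Real.exp (ε N) * ε N) ∧
      ∫ x in Set.Ioo 0 π, v x * Complex.cos (((n : ℂ) + 1) * x) =
        π / 2 * (-1) ^ n * κ n * zeroProd κ n N * h := by
    intro N
    by_cases hN : n < N ∧ Real.exp (ε N) * ε N ≤ 1 / 2
    · obtain ⟨h, hh⟩ := exists_factor hΔ hz hN.1 rfl hN.2
      exact ⟨h, fun _ => hh⟩
    · exact ⟨0, fun h => absurd h hN⟩
  choose h hh using hex
  have hlim : Tendsto h atTop (𝓝 1) := by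
    rw [tendsto_iff_norm_sub_tendsto_zero]
    exact squeeze_zero' (.of_forall fun _ => norm_nonneg _)
      (hsmall.mono fun N hN => (hh N hN).1) hδlim
  have hlim' : Tendsto (fun N => (∫ x in Set.Ioo 0 π, v x * Complex.cos (((n : ℂ) + 1) * x)) / h N)
      atTop (𝓝 (∫ x in Set.Ioo 0 π, v x * Complex.cos (((n : ℂ) + 1) * x))) := by
    have := (tendsto_const_nhds (x := ∫ x in Set.Ioo 0 π,
      v x * Complex.cos (((n : ℂ) + 1) * x))).div hlim one_ne_zero
    rwa [div_one] at this
  refine hlim'.congr' ?_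
  filter_upwards [hsmall, hlim.eventually_ne one_ne_zero] with N hN h0
  rw [(hh N hN).2, mul_div_cancel_right₀ _ h0]

/-! ### Lipschitz dependence on the zeros -/

/-- The `ℓ₂`-norm `√(∑ 1 / k²)` of the sequence `1 / k`, `k ≥ 1`. -/
def harmonicNorm : ℝ := √(∑' k : ℕ, (1 / ((k : ℝ) + 1)) ^ 2)

theorem sqrt_sum_le_harmonicNorm (s : Finset ℕ) :
    √(∑ k ∈ s, (1 / ((k : ℝ) + 1)) ^ 2) ≤ harmonicNorm := by
  refine Real.sqrt_le_sqrt (Summable.sum_le_tsum s (fun _ _ => by positivity) ?_)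
  have := (summable_nat_add_iff 1).2 (Real.summable_one_div_nat_pow (p := 2).2 (by norm_num))
  simpa [div_pow] using this

theorem natCast_add_one_le_norm {k n : ℕ} (h : k ≠ n) :
    (k : ℝ) + 1 ≤ ‖((k : ℂ) + 1) ^ 2 - ((n : ℂ) + 1) ^ 2‖ := by
  rw [sq_sub_sq, norm_mul]
  have h1 : ‖(k : ℂ) + 1 + (n + 1)‖ = k + 1 + (n + 1) := by
    exact_mod_cast Complex.norm_natCast (k + 1 + (n + 1))
  have h2 : 1 ≤ ‖(k : ℂ) + 1 - (n + 1)‖ := by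
    have h3 : (k : ℂ) + 1 - (n + 1) = (((k : ℤ) - n : ℤ) : ℂ) := by push_cast; ring
    rw [h3, Complex.norm_intCast]
    have h4 : 1 ≤ |(k : ℤ) - n| := Int.one_le_abs (sub_ne_zero.2 (by exact_mod_cast h))
    exact_mod_cast h4
  rw [h1]
  have : (0 : ℝ) ≤ n := n.cast_nonneg
  nlinarith

theorem sum_norm_div_le (κ : EllTwo) (n N : ℕ) :
    ∑ k ∈ (Finset.range N).erase n, ‖κ k / (((k : ℂ) + 1) ^ 2 - ((n : ℂ) + 1) ^ 2)‖ ≤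
      ‖κ‖ * harmonicNorm := by
  calc _ ≤ ∑ k ∈ (Finset.range N).erase n, ‖κ k‖ * (1 / ((k : ℝ) + 1)) := by
        refine Finset.sum_le_sum fun k hk => ?_
        rw [norm_div, div_eq_mul_one_div]
        gcongr
        exact natCast_add_one_le_norm (Finset.ne_of_mem_erase hk)
    _ ≤ _ := (sum_norm_mul_le κ _ _).trans (by gcongr; exact sqrt_sum_le_harmonicNorm _)

theorem norm_zeroProd_le (κ : EllTwo) (n N : ℕ) :
    ‖zeroProd κ n N‖ ≤ Real.exp (‖κ‖ * harmonicNorm) :=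
  (norm_prod_one_add_le _ _).trans (Real.exp_le_exp.2 (sum_norm_div_le κ n N))

theorem norm_zeroProd_sub_le (κ κ' : EllTwo) (n N : ℕ) :
    ‖zeroProd κ n N - zeroProd κ' n N‖ ≤
      Real.exp (‖κ‖ * harmonicNorm + ‖κ'‖ * harmonicNorm) * (‖κ - κ'‖ * harmonicNorm) := by
  refine (norm_prod_one_add_sub_prod_one_add_le _ _ _).trans ?_
  gcongr
  · exact sum_norm_div_le κ n N
  · exact sum_norm_div_le κ' n N
  · simpa [sub_div] using sum_norm_div_le (κ - κ') n N

/-- Up to a constant, the difference of corresponding cosine coefficients is bounded by the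
difference of the zeros with index `n`, plus the total difference of the zeros times a factor that
is square summable in `n`. -/
theorem norm_integral_mul_cos_sub_le {v v' : L2} {Δ Δ' : ℂ → ℂ} {κ κ' : EllTwo}
    (hΔ : IsCharFun v Δ) (hΔ' : IsCharFun v' Δ')
    (hz : IsZeroSeq Δ fun n => ((n : ℂ) + 1) ^ 2 + κ n)
    (hz' : IsZeroSeq Δ' fun n => ((n : ℂ) + 1) ^ 2 + κ' n)
    {r : ℝ} (hκ : ‖κ‖ ≤ r) (hκ' : ‖κ'‖ ≤ r) (n : ℕ) :
    ‖(∫ x in Set.Ioo 0 π, v x * Complex.cos (((n : ℂ) + 1) * x)) -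
        ∫ x in Set.Ioo 0 π, v' x * Complex.cos (((n : ℂ) + 1) * x)‖ ≤
      π / 2 * Real.exp (2 * r * harmonicNorm) *
        (‖(κ - κ') n‖ + ‖κ' n‖ * (‖κ - κ'‖ * harmonicNorm)) := by
  have hr : 0 ≤ r := (norm_nonneg _).trans hκ
  have hM : 0 ≤ harmonicNorm := Real.sqrt_nonneg _
  refine le_of_tendsto ((tendsto_zeroProd hΔ hz n).sub (tendsto_zeroProd hΔ' hz' n)).norm
    (.of_forall fun N => ?_)
  set E := Real.exp (2 * r * harmonicNorm)
  have h1 : ‖zeroProd κ n N‖ ≤ E :=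
    (norm_zeroProd_le κ n N).trans (Real.exp_le_exp.2 (by gcongr; linarith))
  have h2 : ‖zeroProd κ n N - zeroProd κ' n N‖ ≤ E * (‖κ - κ'‖ * harmonicNorm) := by
    refine (norm_zeroProd_sub_le κ κ' n N).trans ?_
    refine mul_le_mul_of_nonneg_right (Real.exp_le_exp.2 ?_) (by positivity)
    calc ‖κ‖ * harmonicNorm + ‖κ'‖ * harmonicNorm ≤ r * harmonicNorm + r * harmonicNorm := by
          gcongr
      _ = _ := by ring
  have hpi : ‖(π : ℂ) / 2 * (-1) ^ n‖ = π / 2 := by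
    simp [abs_of_pos Real.pi_pos]
  calc _ = ‖(π : ℂ) / 2 * (-1) ^ n * ((κ - κ') n * zeroProd κ n N
          + κ' n * (zeroProd κ n N - zeroProd κ' n N))‖ := by
        congr 1
        rw [lp.coeFn_sub, Pi.sub_apply]
        ring
    _ ≤ π / 2 * (‖(κ - κ') n‖ * ‖zeroProd κ n N‖
          + ‖κ' n‖ * ‖zeroProd κ n N - zeroProd κ' n N‖) := by
        rw [norm_mul, hpi, ← norm_mul, ← norm_mul]
        gcongr
        exact norm_add_le _ _
    _ ≤ π / 2 * (‖(κ - κ') n‖ * E + ‖κ' n‖ * (E * (‖κ - κ'‖ * harmonicNorm))) := by gcongr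
    _ = _ := by ring

open MeasureTheory in
theorem norm_sq_eq_integral (w : L2) : ‖w‖ ^ 2 = ∫ x in Set.Ioo 0 π, ‖w x‖ ^ 2 := by
  have h : ((‖w‖ ^ 2 : ℝ) : ℂ) = ((∫ x in Set.Ioo 0 π, ‖w x‖ ^ 2 : ℝ) : ℂ) := by
    rw [← integral_complex_ofReal]
    push_cast
    have h1 := inner_self_eq_norm_sq_to_K (𝕜 := ℂ) w
    rw [L2.inner_def] at h1
    simpa [inner_self_eq_norm_sq_to_K] using h1.symm
  exact_mod_cast h

end

theorem theorem6 (r : ℝ) (hr : 0 < r) :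
    ∃ C : ℝ, 0 < C ∧
      ∀ (v v' : L2) (Δ Δ' : ℂ → ℂ) (κ κ' : EllTwo),
        IsCharFun v Δ → IsCharFun v' Δ' →
        IsZeroSeq Δ (fun n => ((n : ℂ) + 1) ^ 2 + κ n) →
        IsZeroSeq Δ' (fun n => ((n : ℂ) + 1) ^ 2 + κ' n) →
        ‖κ‖ ≤ r → ‖κ'‖ ≤ r →
        ‖v - v'‖ ≤ C * ‖κ - κ'‖ := by
  set M := harmonicNorm
  have hM : 0 ≤ M := Real.sqrt_nonneg _
  set E := Real.exp (2 * r * M)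
  have hE : 0 < E := Real.exp_pos _
  have hpi := Real.pi_pos
  -- the constant comes from `(a + b)² ≤ 2 a² + 2 b²`, summed over the cosine coefficients
  refine ⟨√(π * E ^ 2 * (1 + r ^ 2 * M ^ 2)), Real.sqrt_pos.2 (by positivity),
    fun v v' Δ Δ' κ κ' hΔ hΔ' hz hz' hκ hκ' => ?_⟩
  have hint (u : L2) : MeasureTheory.Integrable u (MeasureTheory.volume.restrict (Set.Ioo 0 π)) :=
    (MeasureTheory.Lp.memLp u).integrable (by norm_num)
  have hintcos (u : L2) (n : ℕ) : MeasureTheory.Integrable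
      (fun x : ℝ => u x * Complex.cos (((n : ℂ) + 1) * x))
      (MeasureTheory.volume.restrict (Set.Ioo 0 π)) := by
    refine (hint u).mul_bdd (c := 1) (by fun_prop) (.of_forall fun x => ?_)
    refine (norm_cos_le _).trans_eq ?_
    rw [Complex.im_mul_ofReal]
    simp
  have hsub : ⇑(v - v') =ᵐ[MeasureTheory.volume.restrict (Set.Ioo 0 π)] fun x => v x - v' x :=
    MeasureTheory.Lp.coeFn_sub v v'
  have hmean : ∫ x in Set.Ioo 0 π, (v - v') x = 0 := by
    rw [MeasureTheory.integral_congr_ae hsub, MeasureTheory.integral_sub (hint v) (hint v'),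
      hΔ.mean_zero, hΔ'.mean_zero, sub_zero]
  have hcoef (n : ℕ) : ∫ x in Set.Ioo 0 π, (v - v') x * Complex.cos (((n : ℂ) + 1) * x) =
      (∫ x in Set.Ioo 0 π, v x * Complex.cos (((n : ℂ) + 1) * x)) -
        ∫ x in Set.Ioo 0 π, v' x * Complex.cos (((n : ℂ) + 1) * x) := by
    rw [← MeasureTheory.integral_sub (hintcos v n) (hintcos v' n)]
    refine MeasureTheory.integral_congr_ae ?_
    filter_upwards [hsub] with x hx
    rw [hx, sub_mul]
  have hpars := hasSum_sq_integral_mul_cos (MeasureTheory.Lp.memLp (v - v')) hmean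
  rw [← norm_sq_eq_integral] at hpars
  set D := ‖κ - κ'‖
  have hbound : π / 2 * ‖v - v'‖ ^ 2 ≤ π / 2 * (π * E ^ 2 * (1 + r ^ 2 * M ^ 2) * D ^ 2) := by
    refine hasSum_le_of_sum_le hpars fun s => ?_
    calc _ ≤ ∑ n ∈ s, (π / 2 * E) ^ 2 * (2 * ‖(κ - κ') n‖ ^ 2 + 2 * (D * M) ^ 2 * ‖κ' n‖ ^ 2) := by
          refine Finset.sum_le_sum fun n _ => ?_
          have h := norm_integral_mul_cos_sub_le hΔ hΔ' hz hz' hκ hκ' n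
          rw [← hcoef] at h
          refine (pow_le_pow_left₀ (norm_nonneg _) h 2).trans ?_
          rw [mul_pow]
          gcongr
          nlinarith [sq_nonneg (‖(κ - κ') n‖ - ‖κ' n‖ * (D * M))]
      _ = (π / 2 * E) ^ 2 *
            (2 * ∑ n ∈ s, ‖(κ - κ') n‖ ^ 2 + 2 * (D * M) ^ 2 * ∑ n ∈ s, ‖κ' n‖ ^ 2) := by
          rw [← Finset.mul_sum, Finset.sum_add_distrib, Finset.mul_sum, Finset.mul_sum]
      _ ≤ (π / 2 * E) ^ 2 * (2 * D ^ 2 + 2 * (D * M) ^ 2 * r ^ 2) := by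
          gcongr
          · exact sum_norm_sq_le _ s
          · exact (sum_norm_sq_le _ s).trans (by gcongr)
      _ = _ := by ring
  refine le_of_sq_le_sq ?_ (by positivity)
  rw [mul_pow, Real.sq_sqrt (by positivity)]
  exact le_of_mul_le_mul_left hbound (by positivity)
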